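/- For a C$^*$-algebra $\mathcal A$ with unitization $\mathcal A^+=\mathbb C\oplus\mathcal A$ let $K_0(\mathcal A)=\mathcal V_0(\mathcal A)/\!\sim_0$, where $\mathcal V_0(\mathcal A)$ is the set of selfadjoint invertible $V\in\bigcup_{n\ge1}M_{2n}(\mathcal A^+)$ whose scalar part $s(V)$ is homotopic, within the selfadjoint invertible scalar matrices, to $E_{2n}=E_2^{\oplus n}$, $E_2=\operatorname{diag}(1,-1)$, and $\sim_0$ is generated by homotopy within the selfadjoint invertibles of a fixed $M_{2n}(\mathcal A^+)$ and by $V\sim_0 V\oplus E_2$. Let $K_1(\mathcal A)=\mathcal V_1(\mathcal A)/\!\sim_1$, where $\mathcal V_1(\mathcal A)$ is the set of invertibles in $\bigcup_{n\ge1}M_n(\mathcal A^+)$ and $\sim_1$ is generated by homotopy within the invertibles of a fixed $M_n(\mathcal A^+)$ and by $U\sim_1 U\oplus\mathbf 1$. Let $0\to\mathcal K\to\mathcal A\overset{\pi}{\to}\mathcal Q\to0$ be a short exact sequence of C$^*$-algebras, let $\pi^+:\mathcal A^+\to\mathcal Q^+$ be the unital extension of $\pi$ (applied entrywise to matrices),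 and regard $M_m(\mathcal K^+)$ as a subalgebra of $M_m(\mathcal A^+)$. The exponential map $\mathrm{Exp}:K_0(\mathcal Q)\to K_1(\mathcal K)$ is the well-defined map sending the class of a selfadjoint unitary $V\in\mathcal V_0(\mathcal Q)$ to $[\exp(-2\pi\imath\,\tfrac12(C+\mathbf 1))]_1$ for any selfadjoint lift $C$ of $V$. Let $V\in\mathcal V_0(\mathcal Q)$, $V\in M_{2n}(\mathcal Q^+)$, be a selfadjoint unitary and let $B=B^*\in M_{2n}(\mathcal A^+)$ satisfy $\|B\|\le1$ and $\pi^+(B)=V$. Then $B\sqrt{\mathbf 1-B^2}+\imath(\mathbf 1-2B^2)$ is an invertible element of $M_{2n}(\mathcal K^+)$ and $$\mathrm{Exp}([V]_0)=\big[B\sqrt{\mathbf 1-B^2}+\imath(\mathbf 1-2B^2)\big]_1 .$$ -/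

import Mathlib

noncomputable section

/-- The canonical (spectral) order of the unitization of a C⋆-algebra: `0 ≤ x` iff `x` is
selfadjoint with nonnegative spectrum. It is what the C⋆-norm on matrices is built on. -/
instance Unitization.instPartialOrderSpectral {A : Type*} [NonUnitalCStarAlgebra A] :
    PartialOrder (Unitization ℂ A) := CStarAlgebra.spectralOrder _

instance Unitization.instStarOrderedRingSpectral {A : Type*} [NonUnitalCStarAlgebra A] :
    StarOrderedRing (Unitization ℂ A) := CStarAlgebra.spectralOrderedRing _

namespace CStarKTheory

open Real (pi)

/-- The C⋆-algebra `M_n(A⁺)` of matrices over the unitization `A⁺ = ℂ ⊕ A`. -/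
abbrev MatU (n : ℕ) (A : Type*) : Type _ := CStarMatrix (Fin n) (Fin n) (Unitization ℂ A)

/-- The block diagonal matrix `X ⊕ Y`. -/
def blockSum {R : Type*} [Zero R] {m n : ℕ} (X : CStarMatrix (Fin m) (Fin m) R)
    (Y : CStarMatrix (Fin n) (Fin n) R) : CStarMatrix (Fin (m + n)) (Fin (m + n)) R :=
  CStarMatrix.ofMatrix (Matrix.reindex finSumFinEquiv finSumFinEquiv
    (Matrix.fromBlocks (CStarMatrix.ofMatrix.symm X) 0 0 (CStarMatrix.ofMatrix.symm Y)))

/-- The `2n × 2n` matrix `E_{2n} = diag(1, -1, 1, -1, …, 1, -1)`. -/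
def E (R : Type*) [Ring R] (n : ℕ) : Matrix (Fin (2 * n)) (Fin (2 * n)) R :=
  Matrix.diagonal fun k => if Even (k : ℕ) then 1 else -1

/-- The scalar part `s(V)` of a matrix over `A⁺ = ℂ ⊕ A`. -/
def scalarPart {A : Type*} {n : ℕ} (V : MatU n A) : Matrix (Fin n) (Fin n) ℂ :=
  Matrix.of fun k l => (V k l).fst

/-- A scalar matrix is homotopic to `E_{2n}` within the selfadjoint invertible scalar
matrices. -/
def IsHomotopicToE {n : ℕ} (S : Matrix (Fin (2 * n)) (Fin (2 * n)) ℂ) : Prop :=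
  JoinedIn {X : Matrix (Fin (2 * n)) (Fin (2 * n)) ℂ | IsSelfAdjoint X ∧ IsUnit X} S (E ℂ n)

section KGroups

variable (A : Type*) [NonUnitalCStarAlgebra A]

/-- The set `𝒱₀(A)` of selfadjoint invertibles `V ∈ M_{2n}(A⁺)`, `n ≥ 1`, with scalar part
homotopic to `E_{2n}`. -/
structure V0 where
  /-- half the size of the matrix -/
  half : ℕ
  half_pos : 0 < half
  /-- the matrix -/
  mat : MatU (2 * half) A
  isSelfAdjoint : IsSelfAdjoint mat
  isUnit : IsUnit mat
  scalar : IsHomotopicToE (scalarPart mat)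

/-- The set `𝒱₁(A)` of invertibles in `M_n(A⁺)`, `n ≥ 1`. -/
structure V1 where
  /-- the size of the matrix -/
  size : ℕ
  size_pos : 0 < size
  /-- the matrix -/
  mat : MatU size A
  isUnit : IsUnit mat

variable {A}

/-- The two moves generating `∼₀`: homotopy within the selfadjoint invertibles of a fixed
`M_{2n}(A⁺)`, and `V ∼₀ V ⊕ E₂` with `V ⊕ E₂ ∈ M_{2(n+1)}(A⁺)`. -/
inductive V0.Rel : V0 A → V0 A → Prop
  | homotopy {n : ℕ} (hn : 0 < n) (V W : MatU (2 * n) A) (hV hV' hV'' hW hW' hW'')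
      (h : JoinedIn {X : MatU (2 * n) A | IsSelfAdjoint X ∧ IsUnit X} V W) :
      V0.Rel ⟨n, hn, V, hV, hV', hV''⟩ ⟨n, hn, W, hW, hW', hW''⟩
  | stab {n : ℕ} (hn : 0 < n) (V : MatU (2 * n) A) (hV hV' hV'') (hn' : 0 < n + 1) (hW hW' hW'') :
      V0.Rel ⟨n, hn, V, hV, hV', hV''⟩
        ⟨n + 1, hn', blockSum V (CStarMatrix.ofMatrix (E (Unitization ℂ A) 1)), hW, hW', hW''⟩

/-- The two moves generating `∼₁`: homotopy within the invertibles of a fixed `M_n(A⁺)`, and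
`U ∼₁ U ⊕ 1` with the identity `1` of any size. -/
inductive V1.Rel : V1 A → V1 A → Prop
  | homotopy {n : ℕ} (hn : 0 < n) (U W : MatU n A) (hU hW)
      (h : JoinedIn {X : MatU n A | IsUnit X} U W) :
      V1.Rel ⟨n, hn, U, hU⟩ ⟨n, hn, W, hW⟩
  | stab {n : ℕ} (hn : 0 < n) (U : MatU n A) (hU) {k : ℕ} (hn' : 0 < n + k) (hW) :
      V1.Rel ⟨n, hn, U, hU⟩ ⟨n + k, hn', blockSum U (1 : MatU k A), hW⟩

variable (A)

/-- `K₀(A) = 𝒱₀(A)/∼₀`, with `∼₀` the equivalence relation generated by the two moves. -/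
def K0 : Type _ := Quot (V0.Rel (A := A))

/-- `K₁(A) = 𝒱₁(A)/∼₁`, with `∼₁` the equivalence relation generated by the two moves. -/
def K1 : Type _ := Quot (V1.Rel (A := A))

variable {A}

/-- The class `[V]₀` of `V ∈ 𝒱₀(A)`. -/
def K0.mk (V : V0 A) : K0 A := Quot.mk _ V

/-- The class `[U]₁` of `U ∈ M_n(A⁺)`. -/
def K1.mk {n : ℕ} (hn : 0 < n) (U : MatU n A) (h : IsUnit U) : K1 A := Quot.mk _ ⟨n, hn, U, h⟩

end KGroups

/-- The extension `M_n(A⁺) → M_n(B⁺)` of a ⋆-homomorphism `φ : A → B`, applying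
`φ⁺ : A⁺ → B⁺` to each entry. -/
def mapU {A B : Type*} [NonUnitalCStarAlgebra A] [NonUnitalCStarAlgebra B] (n : ℕ)
    (φ : A →⋆ₙₐ[ℂ] B) : MatU n A →⋆ₐ[ℂ] MatU n B where
  toFun M := M.map (Unitization.starMap φ)
  map_one' := by
    ext k l : 1
    by_cases h : k = l
    · subst h; simp only [CStarMatrix.map_apply, CStarMatrix.one_apply_eq, map_one]
    · simp only [CStarMatrix.map_apply, CStarMatrix.one_apply_ne h, map_zero]
  map_mul' M N := by
    ext k l : 1
    simp only [CStarMatrix.map_apply, CStarMatrix.mul_apply, map_sum, map_mul]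
  map_zero' := by
    ext k l : 1
    simp only [CStarMatrix.map_apply, CStarMatrix.zero_apply, map_zero]
  map_add' M N := by
    ext k l : 1
    simp only [CStarMatrix.map_apply, CStarMatrix.add_apply, map_add]
  commutes' r := by
    ext k l : 1
    by_cases h : k = l
    · simp only [CStarMatrix.map_apply, CStarMatrix.algebraMap_apply, if_pos h, AlgHomClass.commutes]
    · simp only [CStarMatrix.map_apply, CStarMatrix.algebraMap_apply, if_neg h, map_zero]
  map_star' M := by
    ext k l : 1
    simp only [CStarMatrix.map_apply, CStarMatrix.star_apply, map_star]

@[simp]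
theorem mapU_apply {A B : Type*} [NonUnitalCStarAlgebra A] [NonUnitalCStarAlgebra B] (n : ℕ)
    (φ : A →⋆ₙₐ[ℂ] B) (M : MatU n A) (k l : Fin n) :
    mapU n φ M k l = Unitization.starMap φ (M k l) := rfl

/-- A short exact sequence `0 → K → A → Q → 0` of C⋆-algebras. -/
structure Extension (K A Q : Type*) [NonUnitalCStarAlgebra K] [NonUnitalCStarAlgebra A]
    [NonUnitalCStarAlgebra Q] where
  /-- the inclusion `K → A` -/
  incl : K →⋆ₙₐ[ℂ] A
  /-- the quotient map `A → Q` -/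
  proj : A →⋆ₙₐ[ℂ] Q
  injective : Function.Injective incl
  exact : Function.Exact incl proj
  surjective : Function.Surjective proj

/-- `exp(-2πi · ½(C + 1))`. -/
def expHalf {M : Type*} [CStarAlgebra M] (C : M) : M :=
  NormedSpace.exp ((-2 * pi * Complex.I : ℂ) • ((1 / 2 : ℂ) • (C + 1)))

/-- The square root `√X` of a positive element, by continuous functional calculus. -/
def cstarSqrt {M : Type*} [CStarAlgebra M] (X : M) : M := cfc Real.sqrt X

/-! Well-definedness of the exponential map. -/

section generic
variable {M N : Type*} [CStarAlgebra M] [CStarAlgebra N]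

/-- `sgn(V) = V|V|⁻¹` for a selfadjoint invertible `V`. -/
def sgn (V : M) : M := cfc Real.sign V

theorem spectrum_of_sq_eq_one {S : M} (h : S * S = 1) (z : ℂ) (hz : z ∈ spectrum ℂ S) :
    z = 1 ∨ z = -1 := by
  have h1 : z ^ 2 ∈ spectrum ℂ (S ^ 2) := spectrum.pow_mem_pow S 2 hz
  rw [pow_two S, h] at h1
  rcases subsingleton_or_nontrivial M with hM | hM
  · simp [spectrum.of_subsingleton] at h1
  · rw [spectrum.one_eq, Set.mem_singleton_iff] at h1
    exact sq_eq_one_iff.mp h1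

theorem expHalf_eq_one {S : M} (hS : IsSelfAdjoint S) (h : S * S = 1) : expHalf S = 1 := by
  have hn : IsStarNormal S := hS.isStarNormal
  have hsp := spectrum_of_sq_eq_one h
  have h1 : (-2 * pi * Complex.I : ℂ) • ((1 / 2 : ℂ) • (S + 1)) =
      cfc (fun z : ℂ => (-2 * pi * Complex.I : ℂ) • ((1 / 2 : ℂ) • (z + 1))) S := by
    rw [cfc_smul _ _ S, cfc_smul _ _ S, cfc_add .., cfc_id' ℂ S, cfc_const_one ℂ S]
  unfold expHalf
  rw [h1, ← CFC.exp_eq_normedSpace_exp (𝕜 := ℂ), ← cfc_comp' _ _ S, ← cfc_const_one ℂ S]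
  apply cfc_congr
  intro z hz
  rcases hsp z hz with rfl | rfl
  · simp only [← Complex.exp_eq_exp_ℂ, smul_eq_mul]
    rw [show (-2 * pi * Complex.I * (1 / 2 * (1 + 1)) : ℂ) = -(2 * pi * Complex.I) by ring,
      Complex.exp_neg, Complex.exp_two_pi_mul_I, inv_one]
  · simp

theorem continuous_starAlgHom (φ : M →⋆ₐ[ℂ] N) : Continuous φ :=
  AddMonoidHomClass.continuous_of_bound φ 1 fun x => by
    simpa only [one_mul] using NonUnitalStarAlgHom.norm_apply_le φ x

theorem map_expHalf (φ : M →⋆ₐ[ℂ] N) (C : M) : φ (expHalf C) = expHalf (φ C) := by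
  let _ : NormedAlgebra ℚ M := .restrictScalars ℚ ℂ M
  let _ : NormedAlgebra ℚ N := .restrictScalars ℚ ℂ N
  have hφ : Continuous φ := continuous_starAlgHom φ
  unfold expHalf
  rw [NormedSpace.map_exp φ hφ]
  simp only [map_smul, map_add, map_one]

theorem continuous_expHalf : Continuous (expHalf : M → M) := by
  let _ : NormedAlgebra ℚ M := .restrictScalars ℚ ℂ M
  unfold expHalf
  exact NormedSpace.exp_continuous.comp (by fun_prop)

theorem isUnit_expHalf (C : M) : IsUnit (expHalf C) := by
  let _ : NormedAlgebra ℚ M := .restrictScalars ℚ ℂ M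
  unfold expHalf
  exact NormedSpace.isUnit_exp _

theorem continuousOn_sign : ContinuousOn Real.sign {0}ᶜ := by
  intro x hx
  apply ContinuousAt.continuousWithinAt
  rcases lt_or_gt_of_ne (show x ≠ 0 from hx) with h | h
  · exact continuousAt_const.congr (Filter.eventuallyEq_of_mem (Iio_mem_nhds h)
      fun y hy => (Real.sign_of_neg hy).symm)
  · exact continuousAt_const.congr (Filter.eventuallyEq_of_mem (Ioi_mem_nhds h)
      fun y hy => (Real.sign_of_pos hy).symm)

theorem zero_notMem {V : M} (h : IsUnit V) : spectrum ℝ V ⊆ {0}ᶜ := by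
  intro x hx hx0
  rw [Set.mem_singleton_iff] at hx0
  subst hx0
  exact spectrum.zero_notMem ℝ h hx

theorem continuousOn_sign' {V : M} (h : IsUnit V) : ContinuousOn Real.sign (spectrum ℝ V) :=
  continuousOn_sign.mono (zero_notMem h)

theorem isSelfAdjoint_sgn (V : M) : IsSelfAdjoint (sgn V) := cfc_predicate _ _

theorem sgn_mul_sgn {V : M} (hV : IsSelfAdjoint V) (h : IsUnit V) : sgn V * sgn V = 1 := by
  unfold sgn
  have hc := continuousOn_sign' h
  rw [← cfc_mul _ _ V hc hc, ← cfc_const_one ℝ V]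
  apply cfc_congr
  intro x hx
  rcases lt_or_gt_of_ne (show x ≠ 0 from zero_notMem h hx) with h | h
  · simp [Real.sign_of_neg h]
  · simp [Real.sign_of_pos h]

theorem sgn_of_sq_eq_one {V : M} (hV : IsSelfAdjoint V) (h : V * V = 1) : sgn V = V := by
  unfold sgn
  conv_rhs => rw [← cfc_id' ℝ V]
  apply cfc_congr
  intro x hx
  have := spectrum_of_sq_eq_one h (x : ℂ) (spectrum.algebraMap_mem ℂ hx)
  rcases this with h | h
  · have : x = 1 := by exact_mod_cast h
    simp [this, Real.sign_one]
  · have : x = -1 := by exact_mod_cast h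
    simp [this, Real.sign_neg, Real.sign_one]

theorem map_sgn (φ : M →⋆ₐ[ℂ] N) {V : M} (hV : IsSelfAdjoint V) (h : IsUnit V) :
    φ (sgn V) = sgn (φ V) :=
  StarAlgHomClass.map_cfc φ Real.sign V (continuousOn_sign' h) (continuous_starAlgHom φ)
    hV (hV.map φ)

/-- The continuous function which is `x / r` on `[-r, r]` and `±1` outside. -/
def clamp (r : ℝ) (x : ℝ) : ℝ := max (-1) (min 1 (x / r))

theorem continuous_clamp (r : ℝ) : Continuous (clamp r) := by
  unfold clamp; fun_prop

theorem clamp_eq_sign {r x : ℝ} (hr : 0 < r) (hx : r < |x|) : clamp r x = Real.sign x := by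
  unfold clamp
  rcases lt_abs.mp hx with h | h
  · rw [Real.sign_of_pos (hr.trans h), min_eq_left, max_eq_right (by norm_num)]
    rw [le_div_iff₀ hr]; linarith
  · rw [Real.sign_of_neg (by linarith), max_eq_left]
    apply (min_le_right _ _).trans
    rw [div_le_iff₀ hr]; linarith

/-- The spectrum of `V` avoids `[-r, r]`. -/
def Gap (r : ℝ) (V : M) : Prop := ∀ x ∈ spectrum ℝ V, r < |x|

theorem Gap.isUnit {V : M} {r : ℝ} (hr : 0 < r) (h : Gap r V) : IsUnit V := by
  by_contra hV
  have := h 0 (spectrum.zero_mem ℝ hV)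
  simp at this
  linarith

theorem exists_gap {V : M} (h : IsUnit V) : ∃ r > 0, ∃ d > 0, ∀ W ∈ Metric.ball V d,
    ∀ s : unitInterval, Gap r (V + ((s : ℝ) : ℂ) • (W - V)) := by
  have hk : IsCompact (spectrum ℝ V) := spectrum.isCompact V
  obtain ⟨r, hr, hrV⟩ : ∃ r > 0, ∀ x ∈ spectrum ℝ V, r < |x| := by
    rcases (spectrum ℝ V).eq_empty_or_nonempty with he | hne
    · exact ⟨1, one_pos, by simp [he]⟩
    · obtain ⟨x, hx, hmin⟩ := hk.exists_isMinOn hne continuous_abs.continuousOn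
      have hx0 : 0 < |x| := abs_pos.mpr (zero_notMem h hx)
      exact ⟨|x| / 2, by positivity, fun y hy => by
        have : |x| ≤ |y| := hmin hy
        linarith⟩
  have := upperHemicontinuous_iff_forall_isOpen.mp (upperHemicontinuous_spectrum ℝ M) V
    {x | r < |x|} (isOpen_lt continuous_const continuous_abs) hrV
  obtain ⟨d, hd, hball⟩ := Metric.eventually_nhds_iff_ball.mp this
  refine ⟨r, hr, d, hd, fun W hW s x hx => hball _ ?_ hx⟩
  rw [Complex.coe_smul]
  exact (convex_ball V d).add_smul_sub_mem (Metric.mem_ball_self hd) hW s.2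

/-- The functional calculus with `clamp r`. -/
def clampEl (r : ℝ) (B : M) : M := cfc (clamp r) B

theorem isSelfAdjoint_clampEl (r : ℝ) (B : M) : IsSelfAdjoint (clampEl r B) := cfc_predicate _ _

theorem clampEl_eq_sgn {r : ℝ} (hr : 0 < r) {V : M} (h : Gap r V) : clampEl r V = sgn V :=
  cfc_congr fun x hx => clamp_eq_sign hr (h x hx)

theorem map_clampEl (φ : M →⋆ₐ[ℂ] N) (r : ℝ) {B : M} (hB : IsSelfAdjoint B) :
    φ (clampEl r B) = clampEl r (φ B) :=
  StarAlgHomClass.map_cfc φ (clamp r) B (continuous_clamp r).continuousOn (continuous_starAlgHom φ)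
    hB (hB.map φ)

theorem continuous_clampEl {X : Type*} [TopologicalSpace X] (r : ℝ) {L : X → M}
    (hL : Continuous L) (hsa : ∀ x, IsSelfAdjoint (L x)) : Continuous fun x => clampEl r (L x) :=
  Continuous.cfc_of_mem_nhdsSet (s := Set.univ) (clamp r) Filter.univ_mem hL hsa
    (continuous_clamp r).continuousOn

theorem isSelfAdjoint_segment {V W : M} (hV : IsSelfAdjoint V) (hW : IsSelfAdjoint W)
    (s : ℝ) : IsSelfAdjoint (V + (s : ℂ) • (W - V)) :=
  hV.add (IsSelfAdjoint.smul (by simp [isSelfAdjoint_iff]) (hW.sub hV))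

theorem isSelfAdjoint_half (X : M) : IsSelfAdjoint ((1 / 2 : ℂ) • (X + star X)) :=
  IsSelfAdjoint.smul (by simp [isSelfAdjoint_iff]) (IsSelfAdjoint.add_star_self X)

theorem interp_zero (X C Y : M) : X + (1 - (((0 : unitInterval) : ℝ) : ℂ)) • (C - X) +
    (((0 : unitInterval) : ℝ) : ℂ) • Y = C := by simp

theorem interp_one (X C Y : M) : X + (1 - (((1 : unitInterval) : ℝ) : ℂ)) • Y +
    (((1 : unitInterval) : ℝ) : ℂ) • (C - X) = C := by simp

end generic

section blocks

section matrix

variable (R : Type*) [Ring R] {m n : ℕ}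

theorem block_one : Matrix.reindex finSumFinEquiv finSumFinEquiv
    (Matrix.fromBlocks (1 : Matrix (Fin m) (Fin m) R) 0 0 (1 : Matrix (Fin n) (Fin n) R)) = 1 := by
  rw [Matrix.fromBlocks_one]; simp

theorem block_zero : Matrix.reindex finSumFinEquiv finSumFinEquiv
    (Matrix.fromBlocks (0 : Matrix (Fin m) (Fin m) R) 0 0 (0 : Matrix (Fin n) (Fin n) R)) = 0 := by
  rw [Matrix.fromBlocks_zero]; simp

variable {R}

theorem block_mul (X X' : Matrix (Fin m) (Fin m) R) (Y Y' : Matrix (Fin n) (Fin n) R) :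
    Matrix.reindex finSumFinEquiv finSumFinEquiv (Matrix.fromBlocks (X * X') 0 0 (Y * Y')) =
      Matrix.reindex finSumFinEquiv finSumFinEquiv (Matrix.fromBlocks X 0 0 Y) *
      Matrix.reindex finSumFinEquiv finSumFinEquiv (Matrix.fromBlocks X' 0 0 Y') := by
  simp [Matrix.submatrix_mul_equiv, Matrix.fromBlocks_multiply]

theorem block_add (X X' : Matrix (Fin m) (Fin m) R) (Y Y' : Matrix (Fin n) (Fin n) R) :
    Matrix.reindex finSumFinEquiv finSumFinEquiv (Matrix.fromBlocks (X + X') 0 0 (Y + Y')) =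
      Matrix.reindex finSumFinEquiv finSumFinEquiv (Matrix.fromBlocks X 0 0 Y) +
      Matrix.reindex finSumFinEquiv finSumFinEquiv (Matrix.fromBlocks X' 0 0 Y') := by
  rw [Matrix.reindex_apply, Matrix.reindex_apply, Matrix.reindex_apply,
    show Matrix.fromBlocks (X + X') 0 0 (Y + Y') =
      Matrix.fromBlocks X 0 0 Y + Matrix.fromBlocks X' 0 0 Y' by
      simp [Matrix.fromBlocks_add]]
  rfl

theorem E_mul_E : E R n * E R n = 1 := by
  rw [E, Matrix.diagonal_mul_diagonal, ← Matrix.diagonal_one]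
  congr 1; ext k : 1
  split_ifs <;> simp

end matrix

variable {A B : Type*} [NonUnitalCStarAlgebra A] [NonUnitalCStarAlgebra B] {m n : ℕ}

/-- The block diagonal embedding as a ⋆-homomorphism. -/
def blockHom : MatU m A × MatU n A →⋆ₐ[ℂ] MatU (m + n) A where
  toFun p := blockSum p.1 p.2
  map_one' := block_one (Unitization ℂ A)
  map_mul' p q := block_mul (R := Unitization ℂ A) p.1 q.1 p.2 q.2
  map_zero' := block_zero (Unitization ℂ A)
  map_add' p q := block_add (R := Unitization ℂ A) p.1 q.1 p.2 q.2
  commutes' r := by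
    ext k l : 1
    refine Fin.addCases (fun k' => ?_) (fun k' => ?_) k <;>
    refine Fin.addCases (fun l' => ?_) (fun l' => ?_) l <;>
    simp [blockSum, CStarMatrix.algebraMap_apply, Prod.algebraMap_apply, Fin.ext_iff]
    · omega
    · omega
  map_star' p := by
    ext k l : 1
    refine Fin.addCases (fun k' => ?_) (fun k' => ?_) k <;>
    refine Fin.addCases (fun l' => ?_) (fun l' => ?_) l <;>
    simp [blockSum, CStarMatrix.star_apply]

theorem blockHom_apply (X : MatU m A) (Y : MatU n A) : blockHom (X, Y) = blockSum X Y := rfl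

theorem expHalf_blockSum (X : MatU m A) (Y : MatU n A) :
    expHalf (blockSum X Y) = blockSum (expHalf X) (expHalf Y) := by
  rw [← blockHom_apply, ← map_expHalf, ← blockHom_apply]
  congr 1
  ext : 1
  · exact map_expHalf (StarAlgHom.fst ℂ (MatU m A) (MatU n A)) (X, Y)
  · exact map_expHalf (StarAlgHom.snd ℂ (MatU m A) (MatU n A)) (X, Y)

theorem sgn_blockSum {X : MatU m A} {Y : MatU n A} (hX : IsSelfAdjoint X) (hY : IsSelfAdjoint Y)
    (hX' : IsUnit X) (hY' : IsUnit Y) : sgn (blockSum X Y) = blockSum (sgn X) (sgn Y) := by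
  have hsa : IsSelfAdjoint (X, Y) := Prod.ext hX hY
  have hu : IsUnit (X, Y) := Prod.isUnit_iff.mpr ⟨hX', hY'⟩
  rw [← blockHom_apply, ← map_sgn _ hsa hu, ← blockHom_apply]
  congr 1
  ext : 1
  · exact map_sgn (StarAlgHom.fst ℂ (MatU m A) (MatU n A)) hsa hu
  · exact map_sgn (StarAlgHom.snd ℂ (MatU m A) (MatU n A)) hsa hu

theorem isSelfAdjoint_blockSum {X : MatU m A} {Y : MatU n A} (hX : IsSelfAdjoint X)
    (hY : IsSelfAdjoint Y) : IsSelfAdjoint (blockSum X Y) :=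
  IsSelfAdjoint.map (x := (X, Y)) (Prod.ext hX hY) blockHom

theorem mapU_blockSum (φ : A →⋆ₙₐ[ℂ] B) (X : MatU m A) (Y : MatU n A) :
    mapU (m + n) φ (blockSum X Y) = blockSum (mapU m φ X) (mapU n φ Y) := by
  ext k l : 1
  refine Fin.addCases (fun k' => ?_) (fun k' => ?_) k <;>
  refine Fin.addCases (fun l' => ?_) (fun l' => ?_) l <;>
  simp only [mapU_apply, blockSum, CStarMatrix.ofMatrix_apply, Matrix.reindex_apply,
    Matrix.submatrix_apply, finSumFinEquiv_symm_apply_castAdd, finSumFinEquiv_symm_apply_natAdd,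
    Matrix.fromBlocks_apply₁₁, Matrix.fromBlocks_apply₁₂, Matrix.fromBlocks_apply₂₁,
    Matrix.fromBlocks_apply₂₂, CStarMatrix.ofMatrix_symm_apply, Matrix.zero_apply, map_zero]

/-- `E_{2n}` as an element of `M_{2n}(A⁺)`. -/
def EU (A : Type*) [NonUnitalCStarAlgebra A] (n : ℕ) : MatU (2 * n) A :=
  CStarMatrix.ofMatrix (E (Unitization ℂ A) n)

theorem mapU_EU (φ : A →⋆ₙₐ[ℂ] B) : mapU (2 * n) φ (EU A n) = EU B n := by
  ext k l : 1
  simp only [mapU_apply, EU, E, CStarMatrix.ofMatrix_apply, Matrix.diagonal_apply]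
  split_ifs <;> simp only [map_one, map_neg, map_zero]

theorem isSelfAdjoint_EU : IsSelfAdjoint (EU A n) := by
  ext k l : 1
  simp only [CStarMatrix.star_apply, EU, E, CStarMatrix.ofMatrix_apply, Matrix.diagonal_apply]
  by_cases h : k = l
  · subst h; split_ifs <;> simp
  · simp [h, Ne.symm h]

theorem EU_mul_EU : @HMul.hMul _ _ _ instHMul (EU A n) (EU A n) = 1 :=
  E_mul_E (R := Unitization ℂ A)

theorem isUnit_EU : IsUnit (EU A n) := ⟨⟨_, _, EU_mul_EU, EU_mul_EU⟩, rfl⟩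

end blocks

section lifts

variable {K A Q : Type*} [NonUnitalCStarAlgebra K] [NonUnitalCStarAlgebra A]
  [NonUnitalCStarAlgebra Q] {n : ℕ} (e : Extension K A Q)

theorem mapU_incl_injective : Function.Injective (mapU n e.incl) := by
  intro X Y h
  ext k l : 1
  exact Unitization.starMap_injective e.injective (congr_fun (congr_fun h k) l)

theorem mapU_incl_isometry : Isometry (mapU n e.incl) :=
  NonUnitalStarAlgHom.isometry _ (mapU_incl_injective e)

/-- An element of `M_n(A⁺)` with scalar image in `M_n(Q⁺)` comes from `M_n(K⁺)`. -/
theorem exists_preimage (X : MatU n A) (c : ℂ) (hX : mapU n e.proj X = algebraMap ℂ _ c) :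
    ∃ U : MatU n K, mapU n e.incl U = X := by
  have key : ∀ k l, ∃ u : Unitization ℂ K, Unitization.starMap e.incl u = X k l := by
    intro k l
    have h : Unitization.starMap e.proj (X k l) = if k = l then algebraMap ℂ _ c else 0 :=
      congr_fun (congr_fun hX k) l
    have h0 : e.proj (X k l).snd = 0 := by
      have := congr_arg (fun x => x.snd) h
      split_ifs at this <;> simpa [Unitization.algebraMap_eq_inl] using this
    obtain ⟨y, hy⟩ := (e.exact _).mp h0
    refine ⟨Unitization.inl (X k l).fst + Unitization.inr y, ?_⟩
    rw [map_add, Unitization.starMap_inl, Unitization.starMap_inr, hy,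
      Unitization.algebraMap_eq_inl]
    exact Unitization.inl_fst_add_inr_snd_eq _
  choose u hu using key
  exact ⟨CStarMatrix.ofMatrix (Matrix.of u), by ext k l : 1; exact hu k l⟩

theorem exists_lift (V : MatU n Q) (hV : IsSelfAdjoint V) :
    ∃ C : MatU n A, IsSelfAdjoint C ∧ mapU n e.proj C = V := by
  have key : ∀ k l, ∃ u : Unitization ℂ A, Unitization.starMap e.proj u = V k l :=
    fun k l => Unitization.starMap_surjective e.surjective _
  choose u hu using key
  let X : MatU n A := CStarMatrix.ofMatrix (Matrix.of u)
  have hX : mapU n e.proj X = V := by ext k l : 1; exact hu k l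
  refine ⟨(1 / 2 : ℂ) • (X + star X), isSelfAdjoint_half X, ?_⟩
  rw [map_smul, map_add, map_star, hX, hV.star_eq, ← two_smul ℂ V, smul_smul]
  norm_num

/-- `U ∈ M_n(K⁺)` is `exp(-2πi · ½(C + 1))` for a selfadjoint lift `C ∈ M_n(A⁺)` of the selfadjoint
unitary `sgn(V) ∈ M_n(Q⁺)`. -/
def IsExpOf (V : MatU n Q) (U : MatU n K) : Prop :=
  ∃ C : MatU n A, IsSelfAdjoint C ∧ mapU n e.proj C = sgn V ∧ mapU n e.incl U = expHalf C

theorem exists_isExpOf {V : MatU n Q} (hV : IsSelfAdjoint V) (hV' : IsUnit V) :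
    ∃ U : MatU n K, IsExpOf e V U := by
  obtain ⟨C, hC, hCV⟩ := exists_lift e (sgn V) (isSelfAdjoint_sgn V)
  obtain ⟨U, hU⟩ := exists_preimage e (expHalf C) 1 (by
    rw [map_expHalf, hCV, expHalf_eq_one (isSelfAdjoint_sgn V) (sgn_mul_sgn hV hV'), map_one])
  exact ⟨U, C, hC, hCV, hU⟩

theorem isUnit_of_isUnit_incl {U : MatU n K} {c : ℂ} (h : IsUnit (mapU n e.incl U))
    (hc : mapU n e.proj (mapU n e.incl U) = algebraMap ℂ _ c) (hc0 : c ≠ 0) : IsUnit U := by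
  obtain ⟨X, hX⟩ := h
  have hX1 : mapU n e.proj (↑X⁻¹ : MatU n A) = algebraMap ℂ _ c⁻¹ := by
    have h1 : mapU n e.proj (X : MatU n A) * mapU n e.proj (↑X⁻¹ : MatU n A) = 1 := by
      rw [← map_mul, X.mul_inv, map_one]
    rw [hX, hc] at h1
    calc _ = algebraMap ℂ _ c⁻¹ * (algebraMap ℂ _ c * mapU n e.proj (↑X⁻¹ : MatU n A)) := by
          rw [← mul_assoc, ← map_mul, inv_mul_cancel₀ hc0, map_one, one_mul]
      _ = _ := by rw [h1, mul_one]
  obtain ⟨W, hW⟩ := exists_preimage e (↑X⁻¹ : MatU n A) _ hX1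
  refine ⟨⟨U, W, ?_, ?_⟩, rfl⟩ <;> apply mapU_incl_injective e
  · rw [map_mul, hW, ← hX, X.mul_inv, map_one]
  · rw [map_mul, hW, ← hX, X.inv_mul, map_one]

theorem IsExpOf.isUnit {V : MatU n Q} (hV : IsSelfAdjoint V) (hV' : IsUnit V) {U : MatU n K}
    (h : IsExpOf e V U) : IsUnit U := by
  obtain ⟨C, hC, hCV, hU⟩ := h
  refine isUnit_of_isUnit_incl e (c := 1) (hU ▸ isUnit_expHalf C) ?_ one_ne_zero
  rw [hU, map_expHalf, hCV, expHalf_eq_one (isSelfAdjoint_sgn V) (sgn_mul_sgn hV hV'), map_one]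

/-- If the segment from `V` to `W` stays invertible, the exponentials are homotopic. -/
theorem IsExpOf.joinedIn {V W : MatU n Q} (hV : IsSelfAdjoint V) (hW : IsSelfAdjoint W) {r : ℝ}
    (hr : 0 < r) (hgap : ∀ s : unitInterval, Gap r (V + ((s : ℝ) : ℂ) • (W - V)))
    {U U' : MatU n K} (hU : IsExpOf e V U) (hU' : IsExpOf e W U') :
    JoinedIn {X : MatU n K | IsUnit X} U U' := by
  obtain ⟨C, hC, hCV, hCU⟩ := hU
  obtain ⟨D, hD, hDW, hDU⟩ := hU'
  obtain ⟨B, hB, hBV⟩ := exists_lift e V hV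
  obtain ⟨B', hB', hBW⟩ := exists_lift e W hW
  -- the path of lifts
  let L : unitInterval → MatU n A := fun s => B + ((s : ℝ) : ℂ) • (B' - B)
  have hLsa : ∀ s, IsSelfAdjoint (L s) := fun s => isSelfAdjoint_segment hB hB' s
  have hLc : Continuous L := by fun_prop
  let F : unitInterval → MatU n A := fun s => clampEl r (L s)
  have hFc : Continuous F := continuous_clampEl r hLc hLsa
  let G : unitInterval → MatU n A := fun s =>
    F s + (1 - ((s : ℝ) : ℂ)) • (C - F 0) + ((s : ℝ) : ℂ) • (D - F 1)
  have hGc : Continuous G := by fun_prop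
  have hVs : ∀ s : unitInterval, IsSelfAdjoint (V + ((s : ℝ) : ℂ) • (W - V)) := fun s =>
    isSelfAdjoint_segment hV hW s
  have hFs : ∀ s, mapU n e.proj (F s) = sgn (V + ((s : ℝ) : ℂ) • (W - V)) := by
    intro s
    rw [map_clampEl _ r (hLsa s), ← clampEl_eq_sgn hr (hgap s)]
    simp only [L, map_add, map_smul, map_sub, hBV, hBW]
  have hGs : ∀ s, mapU n e.proj (G s) = sgn (V + ((s : ℝ) : ℂ) • (W - V)) := by
    intro s
    have h0 : mapU n e.proj (F 0) = sgn V := by rw [hFs]; simp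
    have h1 : mapU n e.proj (F 1) = sgn W := by rw [hFs]; simp
    simp only [G, map_add, map_smul, map_sub, hFs s, h0, h1, hCV, hDW,
      sub_self, smul_zero, add_zero]
  have hexp : ∀ s, mapU n e.proj (expHalf (G s)) = algebraMap ℂ _ 1 := by
    intro s
    rw [map_expHalf, hGs, expHalf_eq_one (isSelfAdjoint_sgn _)
      (sgn_mul_sgn (hVs s) ((hgap s).isUnit hr)), map_one]
  choose P hP using fun s => exists_preimage e (expHalf (G s)) 1 (hexp s)
  have hPc : Continuous P := by
    rw [(mapU_incl_isometry e).isEmbedding.continuous_iff]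
    have : (mapU n e.incl) ∘ P = fun s => expHalf (G s) := funext hP
    rw [this]
    exact continuous_expHalf.comp hGc
  have hP0 : P 0 = U := by
    apply mapU_incl_injective e
    rw [hP, hCU]; congr 1; exact interp_zero (F 0) C (D - F 1)
  have hP1 : P 1 = U' := by
    apply mapU_incl_injective e
    rw [hP, hDU]; congr 1; exact interp_one (F 1) D (C - F 0)
  refine ⟨⟨⟨P, hPc⟩, hP0, hP1⟩, fun s => ?_⟩
  exact isUnit_of_isUnit_incl e (c := 1) (by
    change IsUnit (mapU n e.incl (P s)); rw [hP]; exact isUnit_expHalf _)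
    (by change mapU n e.proj (mapU n e.incl (P s)) = _; rw [hP, hexp]) one_ne_zero

theorem IsExpOf.k1_eq {V W : MatU n Q} (hn : 0 < n)
    (h : JoinedIn {X : MatU n Q | IsSelfAdjoint X ∧ IsUnit X} V W)
    {U U' : MatU n K} (hU : IsExpOf e V U) (hU' : IsExpOf e W U') (hu : IsUnit U)
    (hu' : IsUnit U') : K1.mk hn U hu = K1.mk hn U' hu' := by
  obtain ⟨γ, hγ⟩ := h
  choose P hP using fun t => exists_isExpOf e (hγ t).1 (hγ t).2
  let f : unitInterval → K1 K := fun t => K1.mk hn (P t) ((hP t).isUnit e (hγ t).1 (hγ t).2)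
  have hf : IsLocallyConstant f := by
    rw [IsLocallyConstant.iff_eventually_eq]
    intro t
    obtain ⟨r, hr, d, hd, hball⟩ := exists_gap (hγ t).2
    have : ∀ᶠ y in nhds t, γ y ∈ Metric.ball (γ t) d :=
      γ.continuous.continuousAt.eventually (Metric.ball_mem_nhds _ hd)
    filter_upwards [this] with y hy
    exact Quot.sound (V1.Rel.homotopy hn _ _ _ _ (IsExpOf.joinedIn e (hγ t).1 (hγ y).1 hr
      (hball _ hy) (hP t) (hP y)).symm)
  have aux : ∀ {X : MatU n Q} (hX : IsSelfAdjoint X) (hX' : IsUnit X) {Y Y' : MatU n K}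
      (hY : IsExpOf e X Y) (hY' : IsExpOf e X Y') (hy hy'),
      K1.mk hn Y hy = K1.mk hn Y' hy' := by
    intro X hX hX' Y Y' hY hY' hy hy'
    obtain ⟨r, hr, d, hd, hball⟩ := exists_gap hX'
    exact Quot.sound (V1.Rel.homotopy hn _ _ _ _ (IsExpOf.joinedIn e hX hX hr 
      (hball X (Metric.mem_ball_self hd)) hY hY'))
  have hP0 : IsExpOf e V (P 0) := by simpa using hP 0
  have hP1 : IsExpOf e W (P 1) := by simpa using hP 1
  have h0 := hγ 0
  have h1 := hγ 1
  rw [γ.source] at h0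
  rw [γ.target] at h1
  calc K1.mk hn U hu = f 0 := aux h0.1 h0.2 hU hP0 _ _
    _ = f 1 := hf.apply_eq_of_isPreconnected isPreconnected_univ trivial trivial
    _ = _ := aux h1.1 h1.2 hP1 hU' _ _

theorem IsExpOf.blockSum {V : MatU n Q} (hV : IsSelfAdjoint V) (hV' : IsUnit V) {U : MatU n K}
    (h : IsExpOf e V U) : IsExpOf e (blockSum V (EU Q 1)) (blockSum U (1 : MatU (2 * 1) K)) := by
  obtain ⟨C, hC, hCV, hU⟩ := h
  refine ⟨CStarKTheory.blockSum C (EU A 1), isSelfAdjoint_blockSum hC isSelfAdjoint_EU, ?_, ?_⟩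
  · rw [mapU_blockSum, hCV, mapU_EU, sgn_blockSum hV isSelfAdjoint_EU hV' isUnit_EU,
      sgn_of_sq_eq_one (V := EU Q 1) isSelfAdjoint_EU EU_mul_EU]
  · rw [mapU_blockSum, hU, map_one, expHalf_blockSum,
      expHalf_eq_one (S := EU A 1) isSelfAdjoint_EU EU_mul_EU]

end lifts

section Exp

variable {K A Q : Type*} [NonUnitalCStarAlgebra K] [NonUnitalCStarAlgebra A]
  [NonUnitalCStarAlgebra Q] (e : Extension K A Q)

/-- The exponential map on representatives: for `V ∈ 𝒱₀(Q)` choose a selfadjoint lift `C` of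
`sgn(V)` (which is `V` if `V` is unitary); then the class of `exp(-2πi · ½(C + 1)) ∈ M_{2n}(K⁺)`. -/
def Extension.expV0 (V : V0 Q) : K1 K :=
  K1.mk (n := 2 * V.half) (Nat.mul_pos two_pos V.half_pos)
    (Classical.choose (exists_isExpOf e V.isSelfAdjoint V.isUnit))
    ((Classical.choose_spec (exists_isExpOf e V.isSelfAdjoint V.isUnit)).isUnit e
      V.isSelfAdjoint V.isUnit)

theorem Extension.expV0_rel (V W : V0 Q) (h : V0.Rel V W) : e.expV0 V = e.expV0 W := by
  cases h with
  | homotopy hn V W hV hV' hV'' hW hW' hW'' h =>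
    exact IsExpOf.k1_eq e _ h (Classical.choose_spec (exists_isExpOf e hV hV'))
      (Classical.choose_spec (exists_isExpOf e hW hW')) _ _
  | @stab n hn V hV hV' hV'' hn' hW hW' hW'' =>
    have h1 := Classical.choose_spec (exists_isExpOf e hV hV')
    have h2 := h1.blockSum e hV hV'
    have hn2 : 0 < 2 * n := Nat.mul_pos two_pos hn
    refine (Quot.sound (V1.Rel.stab hn2 _ (h1.isUnit e hV hV') (k := 2) (by omega)
      (h2.isUnit e hW hW'))).trans ?_
    exact IsExpOf.k1_eq e (n := 2 * (n + 1)) (by omega) (JoinedIn.refl ⟨hW, hW'⟩) h2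
      (Classical.choose_spec (exists_isExpOf e hW hW')) _ _

/-- The exponential map `Exp : K₀(Q) → K₁(K)` of `0 → K → A → Q → 0`: the class of a selfadjoint
unitary `V` is sent to `[exp(-2πi · ½(C + 1))]₁` for any selfadjoint lift `C` of `V`. -/
def Extension.Exp : K0 Q → K1 K := Quot.lift e.expV0 e.expV0_rel

/-- The defining formula of `Exp` holds for every unitary representative `V` and every selfadjoint
lift `C` of it, so that the choices made above are immaterial. -/
theorem Extension.Exp_mk (V : V0 Q) (hV : V.mat ∈ unitary (MatU (2 * V.half) Q))
    (C : MatU (2 * V.half) A) (hC : IsSelfAdjoint C) (hCV : mapU _ e.proj C = V.mat)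
    (U : MatU (2 * V.half) K) (hU : mapU _ e.incl U = expHalf C) (hU' : IsUnit U) :
    e.Exp (K0.mk V) = K1.mk (Nat.mul_pos two_pos V.half_pos) U hU' := by
  have h1 : @HMul.hMul _ _ _ instHMul V.mat V.mat = 1 := by
    have := (Unitary.mem_iff.mp hV).1
    rwa [V.isSelfAdjoint.star_eq] at this
  exact IsExpOf.k1_eq e _ (JoinedIn.refl ⟨V.isSelfAdjoint, V.isUnit⟩)
    (Classical.choose_spec (exists_isExpOf e V.isSelfAdjoint V.isUnit))
    ⟨C, hC, hCV.trans (sgn_of_sq_eq_one (V := V.mat) V.isSelfAdjoint h1).symm, hU⟩ _ _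

end Exp
end CStarKTheory
end

open CStarKTheory

namespace CStarKTheory

open Real (pi)

/-! ### Functional calculus and the scalar homotopy -/

section generic

variable {M N : Type*} [CStarAlgebra M] [CStarAlgebra N]

/-! The contraction `B` is itself an admissible selfadjoint lift of `V`, so `Exp` of the class of
`V` is already represented by `expHalf B`. What remains is a homotopy of invertibles in `M_{2n}(K⁺)`
from `expHalf B` to `sqrtLoop B`.

Both elements are functions of `B`, whose spectrum lies in [-1, 1]. Since exp(-πi(x + 1)) =
-exp(-πix), multiplying by -i gives the curve sin(πx) + i cos(πx), to be compared with x√(1 - x²) +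
i(1 - 2x²). On (-1, 1) the real part of each curve has the sign of x; both curves equal i at x = 0
and -i at x = ±1. Hence no segment joining corresponding points meets 0 (`homotopy_ne_zero`), and by
spectral mapping the segment from -i · `expHalf B` to `sqrtLoop B` consists of invertibles
(`isUnit_segment_expHalf_sqrtLoop`). The factor -i is reached by rotating through scalar phases.

The homotopy stays over `K` because each of its points has a nonzero scalar as image in
`M_{2n}(Q⁺)`: from V² = 1, `expHalf B` maps to 1 and `sqrtLoop B` maps to -i. Such a path lifts
through the isometric inclusion of `M_{2n}(K⁺)` (`joinedIn_of_path_incl`). -/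

theorem expHalf_eq_cfc {B : M} (hB : IsSelfAdjoint B) :
    expHalf B = cfc (fun z : ℂ => Complex.exp (-2 * pi * Complex.I * (1 / 2 * (z + 1)))) B := by
  have hn : IsStarNormal B := hB.isStarNormal
  have h1 : (-2 * pi * Complex.I : ℂ) • ((1 / 2 : ℂ) • (B + 1)) =
      cfc (fun z : ℂ => (-2 * pi * Complex.I : ℂ) • ((1 / 2 : ℂ) • (z + 1))) B := by
    rw [cfc_smul _ _ B, cfc_smul _ _ B, cfc_add .., cfc_id' ℂ B, cfc_const_one ℂ B]
  unfold expHalf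
  rw [h1, ← CFC.exp_eq_normedSpace_exp (𝕜 := ℂ), ← cfc_comp' _ _ B]
  simp only [Complex.exp_eq_exp_ℂ, smul_eq_mul]

/-- The root comes from the real functional calculus, while the loop takes complex values; rewriting
the root over ℂ, through `z.re`, lets the whole loop become a single complex function of `B`. -/
theorem cstarSqrt_one_sub_sq_eq_cfc {B : M} (hB : IsSelfAdjoint B) :
    cstarSqrt (1 - B ^ 2) = cfc (fun z : ℂ => ((√(1 - z.re ^ 2) : ℝ) : ℂ)) B := by
  have h1 : 1 - B ^ 2 = cfc (fun x : ℝ => 1 - x ^ 2) B := by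
    rw [cfc_sub _ _ B, cfc_const_one ℝ B, cfc_pow _ _ B, cfc_id' ℝ B]
  rw [cstarSqrt, h1, ← cfc_comp' _ _ B, cfc_real_eq_complex _ hB]

/-- `B√(1 - B²) + i(1 - 2B²)`. -/
noncomputable def sqrtLoop (B : M) : M := B * cstarSqrt (1 - B ^ 2) + Complex.I • (1 - 2 * B ^ 2)

theorem sqrtLoop_eq_cfc {B : M} (hB : IsSelfAdjoint B) :
    sqrtLoop B = cfc (fun z : ℂ => z * ((√(1 - z.re ^ 2) : ℝ) : ℂ) +
      Complex.I * (1 - 2 * z ^ 2)) B := by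
  have hn : IsStarNormal B := hB.isStarNormal
  have hc : Continuous fun z : ℂ => ((√(1 - z.re ^ 2) : ℝ) : ℂ) :=
    Complex.continuous_ofReal.comp (by fun_prop)
  have hc' : Continuous fun z : ℂ => z * ((√(1 - z.re ^ 2) : ℝ) : ℂ) := continuous_id.mul hc
  rw [cfc_add (a := B) _ _ hc'.continuousOn (by fun_prop),
    cfc_mul _ _ B (by fun_prop) hc.continuousOn, cfc_const_mul _ _ B, cfc_sub _ _ B,
    cfc_const_one ℂ B, cfc_const_mul _ _ B, cfc_pow _ _ B, cfc_id' ℂ B,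
    ← cstarSqrt_one_sub_sq_eq_cfc hB, sqrtLoop, ofNat_smul_eq_nsmul ℂ 2, two_nsmul, two_mul]

/-- The relation φ(B)² = 1 kills 1 - B², hence also its square root, as φ commutes with the
functional calculus; only i(1 - 2) = -i survives. -/
theorem map_sqrtLoop_of_sq_eq_one (φ : M →⋆ₐ[ℂ] N) {B : M} (hB : IsSelfAdjoint B)
    (h : φ B * φ B = 1) : φ (sqrtLoop B) = algebraMap ℂ N (-Complex.I) := by
  have hsa : IsSelfAdjoint (1 - B ^ 2) := (IsSelfAdjoint.one M).sub (hB.pow 2)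
  have h0 : φ (cstarSqrt (1 - B ^ 2)) = 0 := by
    have := StarAlgHomClass.map_cfc φ Real.sqrt (1 - B ^ 2) (by fun_prop)
      (continuous_starAlgHom φ) hsa (hsa.map φ)
    rw [cstarSqrt, this, map_sub, map_one, map_pow, pow_two, h, sub_self]
    simp [cfc_apply_zero]
  have h2 : φ (1 - 2 * B ^ 2) = -1 := by
    rw [two_mul, map_sub, map_add, map_one, map_pow, pow_two, h]; abel
  rw [sqrtLoop, map_add, map_mul, h0, mul_zero, zero_add, map_smul, h2, smul_neg, map_neg,
    Algebra.algebraMap_eq_smul_one]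

theorem re_mem_Icc_of_mem_spectrum {B : M} (hB1 : ‖B‖ ≤ 1) {z : ℂ} (hz : z ∈ spectrum ℂ B) :
    z.re ∈ Set.Icc (-1) 1 := by
  -- The spectral norm bound needs ‖1‖ = 1; in the zero algebra the spectrum is empty.
  have : Nontrivial M := by
    by_contra h
    rw [not_nontrivial_iff_subsingleton] at h
    simp [spectrum.of_subsingleton] at hz
  exact abs_le.mp ((Complex.abs_re_le_norm z).trans ((spectrum.norm_le_norm_of_mem hz).trans hB1))

/-- For 0 < |x| < 1 the real parts of the two endpoints have the same strict sign, so their convex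
combination cannot vanish. At x = 0 and x = ±1 the real parts do vanish, but the imaginary parts
agree, with values 1 and -1 respectively. -/
theorem homotopy_ne_zero {x s : ℝ} (hx : x ∈ Set.Icc (-1) 1) (hs : s ∈ Set.Icc 0 1) :
    (1 - s : ℂ) * (-Complex.I * Complex.exp (-2 * pi * Complex.I * (1 / 2 * (x + 1)))) +
      s * (x * (√(1 - x ^ 2) : ℝ) + Complex.I * (1 - 2 * x ^ 2)) ≠ 0 := by
  have hexp : -Complex.I * Complex.exp (-2 * pi * Complex.I * (1 / 2 * (x + 1))) =
      (Real.sin (pi * x) : ℝ) + (Real.cos (pi * x) : ℝ) * Complex.I := by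
    rw [show (-2 * pi * Complex.I * (1 / 2 * (x + 1)) : ℂ) =
      (-(pi * x : ℝ) : ℂ) * Complex.I - pi * Complex.I by push_cast; ring, Complex.exp_sub,
      Complex.exp_pi_mul_I, Complex.exp_mul_I, Complex.cos_neg, Complex.sin_neg,
      ← Complex.ofReal_cos, ← Complex.ofReal_sin]
    linear_combination (-(Real.sin (pi * x) : ℝ) : ℂ) * Complex.I_sq
  rw [hexp]
  intro h
  have key : (((1 - s) * Real.sin (pi * x) + s * (x * √(1 - x ^ 2)) : ℝ) : ℂ) +
      (((1 - s) * Real.cos (pi * x) + s * (1 - 2 * x ^ 2) : ℝ) : ℂ) * Complex.I = 0 := by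
    rw [← h]; push_cast; ring
  have hre : (1 - s) * Real.sin (pi * x) + s * (x * √(1 - x ^ 2)) = 0 := by
    simpa only [Complex.add_re, Complex.ofReal_re, Complex.re_ofReal_mul, Complex.I_re, mul_zero,
      add_zero, Complex.zero_re] using congr_arg Complex.re key
  have him : (1 - s) * Real.cos (pi * x) + s * (1 - 2 * x ^ 2) = 0 := by
    simpa only [Complex.add_im, Complex.ofReal_im, Complex.im_ofReal_mul, Complex.I_im, mul_one,
      zero_add, Complex.zero_im] using congr_arg Complex.im key
  -- The real part is odd in its argument, so positivity on (0, 1) also settles (-1, 0).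
  have pos : ∀ y : ℝ, 0 < y → y < 1 →
      0 < (1 - s) * Real.sin (pi * y) + s * (y * √(1 - y ^ 2)) := by
    intro y h0 h1
    have hsin : 0 < Real.sin (pi * y) :=
      Real.sin_pos_of_pos_of_lt_pi (by positivity) (by nlinarith [Real.pi_pos])
    have hsqrt : 0 < y * √(1 - y ^ 2) := mul_pos h0 (Real.sqrt_pos.mpr (by nlinarith))
    -- At s = 0 only the sine term remains; for s > 0 the root term is strictly positive, and the
    -- sine term need only be nonnegative, which covers s = 1.
    rcases hs.1.eq_or_lt with rfl | h
    · simpa using hsin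
    · exact add_pos_of_nonneg_of_pos (mul_nonneg (sub_nonneg.mpr hs.2) hsin.le) (mul_pos h hsqrt)
  rcases lt_trichotomy x 0 with hx0 | rfl | hx0
  · rcases hx.1.eq_or_lt with rfl | hx1
    · rw [mul_neg_one, Real.cos_neg, Real.cos_pi] at him
      linarith
    · have := pos (-x) (by linarith) (by linarith)
      rw [mul_neg, Real.sin_neg, neg_sq] at this
      linarith
  · norm_num at him
  · rcases hx.2.eq_or_lt with rfl | hx1
    · rw [mul_one, Real.cos_pi] at him
      linarith
    · exact (pos x hx0 hx1).ne' hre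

/-- The combination is one continuous function of `B`, so it is invertible exactly when that
function has no zero on the spectrum, a subset of [-1, 1]. -/
theorem isUnit_segment_expHalf_sqrtLoop {B : M} (hB : IsSelfAdjoint B) (hB1 : ‖B‖ ≤ 1) {s : ℝ}
    (hs : s ∈ Set.Icc 0 1) :
    IsUnit ((1 - s : ℂ) • (-Complex.I) • expHalf B + (s : ℂ) • sqrtLoop B) := by
  have hn : IsStarNormal B := hB.isStarNormal
  have hc : Continuous fun z : ℂ => z * ((√(1 - z.re ^ 2) : ℝ) : ℂ) +
      Complex.I * (1 - 2 * z ^ 2) :=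
    (continuous_id.mul (Complex.continuous_ofReal.comp (by fun_prop))).add (by fun_prop)
  rw [expHalf_eq_cfc hB, sqrtLoop_eq_cfc hB, ← cfc_const_mul _ _ B (by fun_prop),
    ← cfc_const_mul _ _ B (by fun_prop), ← cfc_const_mul _ _ B hc.continuousOn,
    ← cfc_add (a := B) _ _ (by fun_prop) (hc.const_mul _).continuousOn,
    isUnit_cfc_iff _ B (Continuous.continuousOn (by fun_prop))]
  intro z hz
  have hzr : (z.re : ℂ) = z := (hB.mem_spectrum_eq_re hz).symm
  have := homotopy_ne_zero (re_mem_Icc_of_mem_spectrum hB1 hz) hs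
  rwa [hzr] at this

end generic

/-! ### Lifting the homotopy to the ideal -/

section lifts

variable {K A Q : Type*} [NonUnitalCStarAlgebra K] [NonUnitalCStarAlgebra A]
  [NonUnitalCStarAlgebra Q] {n : ℕ} (e : Extension K A Q)

/-- A path of invertibles of `M_n(A⁺)` with nonzero scalar image in `M_n(Q⁺)` lifts to a path of
invertibles of `M_n(K⁺)`. -/
theorem joinedIn_of_path_incl {U U' : MatU n K} {P : unitInterval → MatU n A} (hP : Continuous P)
    (hunit : ∀ s, IsUnit (P s)) (c : unitInterval → ℂ) (hc : ∀ s, c s ≠ 0)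
    (hproj : ∀ s, mapU n e.proj (P s) = algebraMap ℂ _ (c s))
    (h0 : mapU n e.incl U = P 0) (h1 : mapU n e.incl U' = P 1) :
    JoinedIn {X : MatU n K | IsUnit X} U U' := by
  choose R hR using fun s => exists_preimage e (P s) (c s) (hproj s)
  have hRc : Continuous R := by
    -- The preimages are chosen pointwise; continuity can still be tested after the inclusion, which
    -- is isometric.
    rw [(mapU_incl_isometry e).isEmbedding.continuous_iff,
      show mapU n e.incl ∘ R = P from funext hR]
    exact hP
  refine ⟨⟨⟨R, hRc⟩, mapU_incl_injective e ((hR 0).trans h0.symm),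
    mapU_incl_injective e ((hR 1).trans h1.symm)⟩, fun s => ?_⟩
  exact isUnit_of_isUnit_incl e (c := c s) ((hR s).symm ▸ hunit s)
    ((congr_arg _ (hR s)).trans (hproj s)) (hc s)

/-- For a selfadjoint contraction `B` lifting a selfadjoint unitary, `exp(-2πi · ½(B + 1))` and
`B√(1 - B²) + i(1 - 2B²)` are homotopic within the invertibles of `M_n(K⁺)`. -/
theorem joinedIn_expHalf_sqrtLoop {B : MatU n A} (hB : IsSelfAdjoint B) (hB1 : ‖B‖ ≤ 1)
    (hexp : mapU n e.proj (expHalf B) = 1)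
    (hloop : mapU n e.proj (sqrtLoop B) = algebraMap ℂ _ (-Complex.I)) {U W : MatU n K}
    (hU : mapU n e.incl U = expHalf B) (hW : mapU n e.incl W = sqrtLoop B) :
    JoinedIn {X : MatU n K | IsUnit X} U W := by
  -- The phase runs from 1 to -i, matching the scalar images of the two elements in `M_n(Q⁺)`; the
  -- image along the way is the phase itself.
  have rotation : JoinedIn {X : MatU n K | IsUnit X} U ((-Complex.I) • U) := by
    refine joinedIn_of_path_incl e
      (P := fun s => Complex.exp ((s : ℝ) * (-(pi / 2) * Complex.I)) • expHalf B)
      (by fun_prop) (fun s => ?_)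
      (fun s => Complex.exp ((s : ℝ) * (-(pi / 2) * Complex.I)))
      (fun s => Complex.exp_ne_zero _) (fun s => ?_) ?_ ?_
    · exact (isUnit_expHalf B).smul (Units.mk0 _ (Complex.exp_ne_zero _))
    · rw [map_smul, hexp, Algebra.algebraMap_eq_smul_one]
    · simp [hU]
    · have : Complex.exp (-(pi / 2 * Complex.I)) = -Complex.I := by
        rw [Complex.exp_neg, Complex.exp_pi_div_two_mul_I, Complex.inv_I]
      simp [hU, this]
  -- Both endpoints now have scalar image -i, so the whole segment does.
  refine rotation.trans (joinedIn_of_path_incl e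
    (P := fun s => (1 - ((s : ℝ) : ℂ)) • (-Complex.I) • expHalf B + ((s : ℝ) : ℂ) • sqrtLoop B)
    (by fun_prop) (fun s => isUnit_segment_expHalf_sqrtLoop hB hB1 s.2) (fun _ => -Complex.I)
    (fun _ => neg_ne_zero.mpr Complex.I_ne_zero) (fun s => ?_) ?_ ?_)
  · rw [map_add, map_smul, map_smul, map_smul, hexp, hloop, ← Algebra.algebraMap_eq_smul_one,
      ← add_smul, sub_add_cancel, one_smul]
  · simp [hU]
  · simp [hW]

end lifts

end CStarKTheory

/-! ### The formula for the exponential map -/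

theorem proposition3 {K A Q : Type*} [NonUnitalCStarAlgebra K] [NonUnitalCStarAlgebra A]
    [NonUnitalCStarAlgebra Q] (e : Extension K A Q)
    (V : V0 Q) (hV : V.mat ∈ unitary (MatU (2 * V.half) Q))
    (B : MatU (2 * V.half) A) (hB : IsSelfAdjoint B) (hB1 : ‖B‖ ≤ 1)
    (hBV : mapU (2 * V.half) e.proj B = V.mat) :
    ∃ (U : MatU (2 * V.half) K) (hU : IsUnit U),
      mapU (2 * V.half) e.incl U = B * cstarSqrt (1 - B ^ 2) + Complex.I • (1 - 2 * B ^ 2) ∧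
      e.Exp (K0.mk V) = K1.mk (Nat.mul_pos two_pos V.half_pos) U hU := by
  have hVV : @HMul.hMul _ _ _ instHMul V.mat V.mat = 1 := by
    have := (Unitary.mem_iff.mp hV).1
    rwa [V.isSelfAdjoint.star_eq] at this
  have hexp : mapU _ e.proj (expHalf B) = 1 := by
    rw [map_expHalf, hBV, expHalf_eq_one V.isSelfAdjoint hVV]
  have hloop : mapU _ e.proj (sqrtLoop B) = algebraMap ℂ _ (-Complex.I) :=
    map_sqrtLoop_of_sq_eq_one _ hB (by rw [hBV]; exact hVV)
  obtain ⟨U, hU⟩ := exists_preimage e (expHalf B) 1 (by rw [hexp, map_one])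
  obtain ⟨W, hW⟩ := exists_preimage e (sqrtLoop B) _ hloop
  have hj := joinedIn_expHalf_sqrtLoop e hB hB1 hexp hloop hU hW
  -- Invertibility of both elements over `K` is read off from the endpoints of the path, and `Exp`
  -- is evaluated with `B` itself as the lift.
  exact ⟨W, hj.target_mem, hW, (e.Exp_mk V hV B hB hBV U hU hj.source_mem).trans
    (Quot.sound (V1.Rel.homotopy _ _ _ _ _ hj))⟩
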